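/- For an integer $n>2$ and a real number $d$, let $\mathcal M^{\mathbb R}_n(d)$ be the set of all real symmetric orthogonal $n\times n$ matrices $\mathcal S$ whose diagonal entries all have the same absolute value, whose off-diagonal entries all have the same nonzero absolute value, and which satisfy $|\mathcal S_{jj}|/|\mathcal S_{jk}|=d$ for all $j\neq k$. A real Hadamard matrix of order $N$ is an $N\times N$ matrix $H$ with entries in $\{-1,1\}$ such that $HH^T=NI$. Let $n>2$ be an integer. Then there exists a matrix $\mathcal S\in\mathcal M^{\mathbb R}_n\left(\frac n4-\frac32\right)$ if and only if $\frac n2+1$ is an integer and there exists a real Hadamard matrix of order $\frac n2+1$. -/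

import Mathlib

/-- A real square matrix is modularly permutation-symmetric (MPS) if its diagonal entries all have
the same modulus `a` and its off-diagonal entries all have the same modulus `b`. -/
def IsMPS {n : ℕ} (M : Matrix (Fin n) (Fin n) ℝ) : Prop :=
  ∃ a b : ℝ, 0 ≤ a ∧ 0 ≤ b ∧ (∀ j, |M j j| = a) ∧ ∀ j k, j ≠ k → |M j k| = b

/-- The set of symmetric orthogonal (that is, real Hermitian unitary) MPS matrices of order `n`
whose off-diagonal entries are nonzero and whose ratio of the modulus of the diagonal entries to
the modulus of the off-diagonal entries is `d`. -/
def realM (n : ℕ) (d : ℝ) : Set (Matrix (Fin n) (Fin n) ℝ) :=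
  {S | S ∈ Matrix.orthogonalGroup (Fin n) ℝ ∧ IsMPS S ∧
    (∀ j k, j ≠ k → S j k ≠ 0 ∧ |S j j| / |S j k| = d) ∧ S.IsSymm}

/-! Write n = 4m + 2, so that d = m - 1 and the Hadamard order is 2m + 2. From a normalised Hadamard
matrix with core K one forms the block matrix with diagonal blocks ±(mI - J) and off-diagonal blocks
K, Kᵀ; it squares to the scalar (m + 1)² + 1 (`coreDouble_mul_self`), and rescaling gives S.
Conversely, dividing S by its off-diagonal modulus leaves a sign matrix with diagonal ±d, and parity
forces n ≡ 2 mod 4 (`IsSignSymm.card_eq`). For m > 1 a norm estimate on three rows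
(`IsSignSymm.triple`) determines the sign of every triangle inside a class of equal diagonal sign,
so after sign changes the diagonal blocks are again ±(mI - J). Counting makes both blocks of size 2m
+ 1, and the block between them, up to a global sign, is a Hadamard core
(`exists_isHadamard_of_blocks`). For m = 1 a matrix of order 4 is exhibited. -/

/-- The core of a real Hadamard matrix: the matrix is normalised so that its first row and its
first column consist of ones, and these are then removed. -/
def hadamardCore {k : ℕ} (H : Matrix (Fin (k + 1)) (Fin (k + 1)) ℝ) : Matrix (Fin k) (Fin k) ℝ :=
  fun i j => H 0 0 * H i.succ 0 * H 0 j.succ * H i.succ j.succ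

/-! ### Signs and Hadamard matrices -/

theorem sum_signs_eq {ι : Type*} (s : Finset ι) (f : ι → ℝ) (h : ∀ i ∈ s, f i = 1 ∨ f i = -1) :
    ∃ z : ℤ, ∑ i ∈ s, f i = (s.card : ℝ) + 2 * z := by
  classical
  induction s using Finset.induction_on with
  | empty => exact ⟨0, by simp⟩
  | insert a s ha ih =>
    obtain ⟨z, hz⟩ := ih fun i hi => h i (Finset.mem_insert_of_mem hi)
    rw [Finset.sum_insert ha, Finset.card_insert_of_notMem ha, hz]
    rcases h a (Finset.mem_insert_self a s) with h1 | h1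
    · exact ⟨z, by rw [h1]; push_cast; ring⟩
    · exact ⟨z - 1, by rw [h1]; push_cast; ring⟩

theorem mul_signs {a b : ℝ} (ha : a = 1 ∨ a = -1) (hb : b = 1 ∨ b = -1) :
    a * b = 1 ∨ a * b = -1 := by
  rcases ha with rfl | rfl <;> rcases hb with rfl | rfl <;> simp

theorem mul_self_of_sign {a : ℝ} (ha : a = 1 ∨ a = -1) : a * a = 1 := by
  rcases ha with rfl | rfl <;> simp

theorem Matrix.IsHadamard.eq_one_or_neg_one {ι : Type*} [Fintype ι] [DecidableEq ι]
    {H : Matrix ι ι ℝ} (hH : H.IsHadamard) (i j : ι) : H i j = 1 ∨ H i j = -1 := by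
  have h := (Unitary.mem_iff.mp (hH.apply_mem i j)).1
  rw [star_trivial] at h
  exact mul_self_eq_one_iff.mp h

theorem Matrix.IsHadamard.sum_mul {ι : Type*} [Fintype ι] [DecidableEq ι]
    {H : Matrix ι ι ℝ} (hH : H.IsHadamard) (i j : ι) :
    ∑ k, H i k * H j k = if i = j then (Fintype.card ι : ℝ) else 0 := by
  have h := congr_fun (congr_fun hH.mul_conjTranspose i) j
  simpa [Matrix.mul_apply, Matrix.one_apply] using h

theorem Matrix.isHadamard_of_signs {ι : Type*} [Fintype ι] [DecidableEq ι] [Nonempty ι]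
    {H : Matrix ι ι ℝ} (hs : ∀ i j, H i j = 1 ∨ H i j = -1)
    (ho : ∀ i j, i ≠ j → ∑ k, H i k * H j k = 0) : H.IsHadamard := by
  refine Matrix.IsHadamard.of_mul_conjTranspose ?_ ?_ ?_
  · intro i j
    rw [Unitary.mem_iff, star_trivial]
    exact ⟨mul_self_of_sign (hs i j), mul_self_of_sign (hs i j)⟩
  · ext i j
    by_cases hij : i = j
    · subst hij
      simp [Matrix.mul_apply, mul_self_of_sign (hs _ _)]
    · simp [Matrix.mul_apply, hij, ho i j hij]
  · exact IsRegular.of_ne_zero (by exact_mod_cast Fintype.card_ne_zero)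

theorem exists_isHadamard_four : ∃ H : Matrix (Fin 4) (Fin 4) ℝ, H.IsHadamard := by
  refine ⟨!![1, 1, 1, 1; 1, -1, 1, -1; 1, 1, -1, -1; 1, -1, -1, 1],
    Matrix.isHadamard_of_signs ?_ ?_⟩
  · intro i j
    fin_cases i <;> fin_cases j <;> simp
  · intro i j hij
    fin_cases i <;> fin_cases j <;> simp_all [Fin.sum_univ_four]

/-! ### From a Hadamard matrix to S -/

theorem hadamardCore_transpose {k : ℕ} (H : Matrix (Fin (k + 1)) (Fin (k + 1)) ℝ) :
    hadamardCore H.transpose = (hadamardCore H).transpose := by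
  ext i j
  simp only [hadamardCore, Matrix.transpose_apply]
  ring

theorem hadamardCore_sign {k : ℕ} {H : Matrix (Fin (k + 1)) (Fin (k + 1)) ℝ} (hH : H.IsHadamard)
    (i j : Fin k) : hadamardCore H i j = 1 ∨ hadamardCore H i j = -1 :=
  mul_signs (mul_signs (mul_signs (hH.eq_one_or_neg_one _ _) (hH.eq_one_or_neg_one _ _))
    (hH.eq_one_or_neg_one _ _)) (hH.eq_one_or_neg_one _ _)

theorem hadamardCore_mul_transpose {k : ℕ} {H : Matrix (Fin (k + 1)) (Fin (k + 1)) ℝ}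
    (hH : H.IsHadamard) : hadamardCore H * (hadamardCore H).transpose =
      ((k : ℝ) + 1) • (1 : Matrix (Fin k) (Fin k) ℝ) - Matrix.of fun _ _ => 1 := by
  ext i j
  have h := hH.sum_mul i.succ j.succ
  rw [Fin.sum_univ_succ] at h
  have key : ∀ l : Fin k, hadamardCore H i l * hadamardCore H j l =
      (H i.succ 0 * H j.succ 0) * (H i.succ l.succ * H j.succ l.succ) := by
    intro l
    have h1 := mul_self_of_sign (hH.eq_one_or_neg_one 0 0)
    have h2 := mul_self_of_sign (hH.eq_one_or_neg_one 0 l.succ)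
    simp only [hadamardCore]
    linear_combination (H i.succ 0 * H j.succ 0) * (H i.succ l.succ * H j.succ l.succ) *
      (H 0 l.succ * H 0 l.succ * h1 + h2)
  have hi := mul_self_of_sign (hH.eq_one_or_neg_one i.succ 0)
  have hj := mul_self_of_sign (hH.eq_one_or_neg_one j.succ 0)
  simp only [Matrix.mul_apply, Matrix.transpose_apply, key, ← Finset.mul_sum]
  by_cases hij : i = j
  · subst hij
    simp only [if_true, Fintype.card_fin] at h
    push_cast at h
    simp only [Matrix.sub_apply, Matrix.smul_apply, Matrix.one_apply_eq, Matrix.of_apply,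
      smul_eq_mul]
    rw [hi, one_mul]
    linarith
  · have hs : i.succ ≠ j.succ := fun e => hij (Fin.succ_injective _ e)
    rw [if_neg hs] at h
    simp only [Matrix.sub_apply, Matrix.smul_apply, Matrix.one_apply_ne hij, Matrix.of_apply,
      smul_eq_mul]
    linear_combination (H i.succ 0 * H j.succ 0) * h - hi * (H j.succ 0 * H j.succ 0) - hj

theorem hadamardCore_row_sum {k : ℕ} {H : Matrix (Fin (k + 1)) (Fin (k + 1)) ℝ}
    (hH : H.IsHadamard) (i : Fin k) : ∑ j, hadamardCore H i j = -1 := by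
  have h := hH.sum_mul 0 i.succ
  rw [Fin.sum_univ_succ, if_neg (Fin.succ_ne_zero i).symm] at h
  have key : ∀ l : Fin k, hadamardCore H i l =
      (H 0 0 * H i.succ 0) * (H 0 l.succ * H i.succ l.succ) := fun l => by
    simp only [hadamardCore]; ring
  have hi := mul_self_of_sign (hH.eq_one_or_neg_one i.succ 0)
  have h0 := mul_self_of_sign (hH.eq_one_or_neg_one 0 0)
  simp only [key, ← Finset.mul_sum]
  linear_combination (H 0 0 * H i.succ 0) * h - hi * (H 0 0 * H 0 0) - h0

theorem hadamardCore_mul_ones {k : ℕ} {H : Matrix (Fin (k + 1)) (Fin (k + 1)) ℝ}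
    (hH : H.IsHadamard) : hadamardCore H * (Matrix.of fun _ _ => 1) =
      -(Matrix.of fun _ _ => 1 : Matrix (Fin k) (Fin k) ℝ) := by
  ext i j
  simp [Matrix.mul_apply, hadamardCore_row_sum hH]

/-- The symmetric block matrix built from a core `K`, with diagonal blocks `±(m • 1 - J)`. -/
def coreDouble {k : ℕ} (m : ℝ) (K : Matrix (Fin k) (Fin k) ℝ) :
    Matrix (Fin k ⊕ Fin k) (Fin k ⊕ Fin k) ℝ :=
  Matrix.fromBlocks (m • 1 - Matrix.of fun _ _ => 1) K K.transpose
    ((Matrix.of fun _ _ => 1) - m • 1)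

/-- The relation k = 2m + 1 makes (mI - J)² = m²I + J, whose J cancels against KKᵀ = (k + 1)I - J;
the mixed blocks vanish because K commutes with J. -/
theorem coreDouble_mul_self {k : ℕ} {H : Matrix (Fin (k + 1)) (Fin (k + 1)) ℝ}
    (hH : H.IsHadamard) (m : ℝ) (hm : 2 * m = (k : ℝ) - 1) :
    coreDouble m (hadamardCore H) * coreDouble m (hadamardCore H) =
      ((m + 1) ^ 2 + 1) • (1 : Matrix (Fin k ⊕ Fin k) (Fin k ⊕ Fin k) ℝ) := by
  set J : Matrix (Fin k) (Fin k) ℝ := Matrix.of fun _ _ => 1 with hJ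
  set K := hadamardCore H with hK
  have hJt : J.transpose = J := rfl
  have hJJ : J * J = (k : ℝ) • J := by
    ext i j
    simp [hJ, Matrix.mul_apply]
  have hKJ : K * J = -J := hadamardCore_mul_ones hH
  have hKtJ : K.transpose * J = -J := by
    rw [hK, ← hadamardCore_transpose]
    exact hadamardCore_mul_ones hH.transpose
  have hJK : J * K = -J := by
    have := congr_arg Matrix.transpose hKtJ
    simpa [Matrix.transpose_mul, hJt] using this
  have hJKt : J * K.transpose = -J := by
    have := congr_arg Matrix.transpose hKJ
    simpa [Matrix.transpose_mul, hJt] using this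
  have hKK : K * K.transpose = ((k : ℝ) + 1) • (1 : Matrix (Fin k) (Fin k) ℝ) - J :=
    hadamardCore_mul_transpose hH
  have hKK' : K.transpose * K = ((k : ℝ) + 1) • (1 : Matrix (Fin k) (Fin k) ℝ) - J := by
    have := hadamardCore_mul_transpose hH.transpose
    rwa [hadamardCore_transpose, Matrix.transpose_transpose] at this
  have hk : (k : ℝ) = 2 * m + 1 := by linarith
  rw [hk] at hJJ hKK hKK'
  have hD : coreDouble m K = Matrix.fromBlocks (m • 1 - J) K K.transpose (J - m • 1) := rfl
  rw [hD, Matrix.fromBlocks_multiply, ← Matrix.fromBlocks_one, Matrix.fromBlocks_smul]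
  congr 1
  · simp only [sub_mul, mul_sub, hJJ, hKK, smul_mul_assoc, mul_smul_comm, one_mul, mul_one]
    module
  · simp only [sub_mul, mul_sub, hKJ, hJK, smul_mul_assoc, mul_smul_comm, one_mul, mul_one]
    module
  · simp only [sub_mul, mul_sub, hKtJ, hJKt, smul_mul_assoc, mul_smul_comm, one_mul, mul_one]
    module
  · simp only [sub_mul, mul_sub, hJJ, hKK', smul_mul_assoc, mul_smul_comm, one_mul, mul_one]
    module

theorem exists_mem_realM_of_isHadamard {k : ℕ} (hk : 1 < k)
    {H : Matrix (Fin (k + 1)) (Fin (k + 1)) ℝ} (hH : H.IsHadamard) :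
    ∃ S, S ∈ realM (k + k) (((k : ℝ) - 3) / 2) := by
  -- Orthogonality of two rows makes k + 1 even; k ≥ 3 is needed for the ratio (k - 3)/2 to be
  -- nonnegative.
  have hk3 : 3 ≤ k := by
    obtain ⟨z, hz⟩ := sum_signs_eq Finset.univ (fun j => H 0 j * H 1 j) fun j _ =>
      mul_signs (hH.eq_one_or_neg_one 0 j) (hH.eq_one_or_neg_one 1 j)
    have h01 : (0 : Fin (k + 1)) ≠ 1 := by
      intro h
      have := congr_arg Fin.val h
      rw [Fin.val_one', Nat.mod_eq_of_lt (by omega)] at this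
      simp at this
    rw [hH.sum_mul, if_neg h01, Finset.card_univ, Fintype.card_fin] at hz
    have : (0 : ℤ) = ((k + 1 : ℕ) : ℤ) + 2 * z := by exact_mod_cast hz
    omega
  have hk3' : (3 : ℝ) ≤ k := by exact_mod_cast hk3
  set m : ℝ := ((k : ℝ) - 1) / 2 with hm
  set T := coreDouble m (hadamardCore H) with hT
  set r : ℝ := (m + 1) ^ 2 + 1 with hr
  have hr0 : 0 < r := by positivity
  have hTT : T * T = r • 1 := coreDouble_mul_self hH m (by rw [hm]; ring)
  have hTs : T.transpose = T := by
    rw [hT, coreDouble, Matrix.fromBlocks_transpose, Matrix.transpose_transpose]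
    congr 1 <;> simp only [Matrix.transpose_sub, Matrix.transpose_smul, Matrix.transpose_one] <;> rfl
  have hTd : ∀ x, |T x x| = ((k : ℝ) - 3) / 2 := by
    rintro (x | x)
    · have : T (Sum.inl x) (Sum.inl x) = ((k : ℝ) - 3) / 2 := by
        simp [hT, coreDouble, hm]; ring
      rw [this, abs_of_nonneg (by linarith)]
    · have : T (Sum.inr x) (Sum.inr x) = -(((k : ℝ) - 3) / 2) := by
        simp [hT, coreDouble, hm]; ring
      rw [this, abs_neg, abs_of_nonneg (by linarith)]
  have hTo : ∀ x y, x ≠ y → |T x y| = 1 := by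
    have habs : ∀ i j, |hadamardCore H i j| = 1 := fun i j => by
      rcases hadamardCore_sign hH i j with h | h <;> simp [h]
    rintro (x | x) (y | y) hxy
    · have : x ≠ y := fun e => hxy (by rw [e])
      simp [hT, coreDouble, this]
    · simp [hT, coreDouble, habs]
    · simp [hT, coreDouble, habs]
    · have : x ≠ y := fun e => hxy (by rw [e])
      simp [hT, coreDouble, this]
  have hs0 : 0 < (√r)⁻¹ := by positivity
  let e : Fin (k + k) ≃ Fin k ⊕ Fin k := finSumFinEquiv.symm
  set S : Matrix (Fin (k + k)) (Fin (k + k)) ℝ := (√r)⁻¹ • T.submatrix e e with hS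
  have hSS : S.transpose = S := by
    rw [hS, Matrix.transpose_smul, Matrix.transpose_submatrix, hTs]
  have hSd : ∀ j, |S j j| = (√r)⁻¹ * (((k : ℝ) - 3) / 2) := fun j => by
    rw [hS, Matrix.smul_apply, smul_eq_mul, abs_mul, abs_of_pos hs0, Matrix.submatrix_apply, hTd]
  have hSo : ∀ j l, j ≠ l → |S j l| = (√r)⁻¹ := fun j l h => by
    rw [hS, Matrix.smul_apply, smul_eq_mul, abs_mul, abs_of_pos hs0, Matrix.submatrix_apply,
      hTo _ _ (fun h' => h (e.injective h')), mul_one]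
  refine ⟨S, ?_, ⟨_, _, ?_, hs0.le, hSd, hSo⟩, ?_, hSS⟩
  · rw [Matrix.mem_orthogonalGroup_iff, hSS, hS, smul_mul_assoc, mul_smul_comm,
      Matrix.submatrix_mul_equiv, hTT]
    have h1 : (r • (1 : Matrix (Fin k ⊕ Fin k) (Fin k ⊕ Fin k) ℝ)).submatrix e e = r • 1 := by
      rw [← Matrix.submatrix_one_equiv e]
      rfl
    rw [h1, smul_smul, smul_smul, ← mul_inv, Real.mul_self_sqrt hr0.le,
      inv_mul_cancel₀ hr0.ne', one_smul]
  · exact mul_nonneg hs0.le (by linarith)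
  · intro j l h
    refine ⟨fun h0 => ?_, ?_⟩
    · have := hSo j l h
      rw [h0, abs_zero] at this
      exact hs0.ne this
    · rw [hSd, hSo j l h, mul_div_assoc, mul_comm, div_mul_cancel₀]
      exact hs0.ne'

/-! ### Normal form of sign matrices -/

/-- A real symmetric matrix with signs off the diagonal, with diagonal entries `ε i * d` for signs
`ε i`, and with pairwise orthogonal rows. -/
structure IsSignSymm {ι : Type*} [Fintype ι] (d : ℝ) (ε : ι → ℝ) (M : Matrix ι ι ℝ) : Prop where
  symm : ∀ i j, M i j = M j i
  sign : ∀ i, ε i = 1 ∨ ε i = -1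
  diag : ∀ i, M i i = ε i * d
  off : ∀ i j, i ≠ j → M i j = 1 ∨ M i j = -1
  orth : ∀ i j, i ≠ j → ∑ k, M i k * M j k = 0

namespace IsSignSymm

variable {ι : Type*} [Fintype ι] {d : ℝ} {ε : ι → ℝ} {M : Matrix ι ι ℝ}

theorem neg (h : IsSignSymm d ε M) : IsSignSymm d (-ε) (-M) where
  symm i j := by simp [h.symm i j]
  sign i := by rcases h.sign i with h | h <;> simp [h]
  diag i := by simp [h.diag i]
  off i j hij := by rcases h.off i j hij with h | h <;> simp [h]
  orth i j hij := by simpa using h.orth i j hij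

theorem conj_signs (h : IsSignSymm d ε M) {t : ι → ℝ} (ht : ∀ i, t i = 1 ∨ t i = -1) :
    IsSignSymm d ε (Matrix.of fun i j => t i * M i j * t j) where
  symm i j := by simp only [Matrix.of_apply]; rw [h.symm i j]; ring
  sign := h.sign
  diag i := by
    have := mul_self_of_sign (ht i)
    simp only [Matrix.of_apply, h.diag i]
    linear_combination (ε i * d) * this
  off i j hij := mul_signs (mul_signs (ht i) (h.off i j hij)) (ht j)
  orth i j hij := by
    have : ∀ k, t i * M i k * t k * (t j * M j k * t k) = (t i * t j) * (M i k * M j k) := by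
      intro k
      linear_combination (t i * M i k * t j * M j k) * mul_self_of_sign (ht k)
    simp only [Matrix.of_apply, this, ← Finset.mul_sum, h.orth i j hij, mul_zero]

theorem sum_mul_self [DecidableEq ι] (h : IsSignSymm d ε M) (i : ι) :
    ∑ k, M i k * M i k = d ^ 2 + Fintype.card ι - 1 := by
  have : ∀ k, M i k * M i k = 1 + if k = i then d ^ 2 - 1 else 0 := by
    intro k
    by_cases hk : k = i
    · subst hk
      rw [if_pos rfl, h.diag]
      linear_combination d ^ 2 * mul_self_of_sign (h.sign k)
    · rw [if_neg hk, mul_self_of_sign (h.off i k (Ne.symm hk)), add_zero]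
  simp only [this, Finset.sum_add_distrib, Finset.sum_ite_eq', Finset.mem_univ, if_true]
  simp
  ring

/-- If the product were 1, the rows could be combined with signs so that the entries at i, j, k have
modulus d + 2. Every other entry is a sum of three signs, hence odd and of square at least 1.
Comparing with the norm given by orthogonality yields 6d + 6 ≤ n. -/
theorem triple [DecidableEq ι] (h : IsSignSymm d ε M) (hd : (Fintype.card ι : ℝ) < 6 * d + 6)
    {i j k : ι} (hij : i ≠ j) (hik : i ≠ k) (hjk : j ≠ k) (hi : ε i = 1) (hj : ε j = 1)
    (hk : ε k = 1) : M i j * M j k * M i k = -1 := by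
  have hp := h.off i j hij
  have hq := h.off j k hjk
  have hr := h.off i k hik
  refine (mul_signs (mul_signs hp hq) hr).resolve_left fun h1 => ?_
  have hpp := mul_self_of_sign hp
  have hqq := mul_self_of_sign hq
  have hrr := mul_self_of_sign hr
  set p := M i j with hpdef
  set q := M j k with hqdef
  set r := M i k with hrdef
  have hsum : ∑ l, (q * M i l + r * M j l + p * M k l) ^ 2 =
      3 * (d ^ 2 + Fintype.card ι - 1) := by
    have : ∀ l, (q * M i l + r * M j l + p * M k l) ^ 2 =
        M i l * M i l + M j l * M j l + M k l * M k l + (2 * q * r) * (M i l * M j l) +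
        (2 * q * p) * (M i l * M k l) + (2 * r * p) * (M j l * M k l) := by
      intro l
      linear_combination (M i l) ^ 2 * hqq + (M j l) ^ 2 * hrr + (M k l) ^ 2 * hpp
    simp only [this, Finset.sum_add_distrib, ← Finset.mul_sum, h.sum_mul_self, h.orth i j hij,
      h.orth i k hik, h.orth j k hjk]
    ring
  have hle : ∀ l, 1 + ((if l = i then (d + 2) ^ 2 - 1 else 0) +
      (if l = j then (d + 2) ^ 2 - 1 else 0) + if l = k then (d + 2) ^ 2 - 1 else 0) ≤
      (q * M i l + r * M j l + p * M k l) ^ 2 := by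
    intro l
    have hji : M j i = p := h.symm j i
    have hki : M k i = r := h.symm k i
    have hkj : M k j = q := h.symm k j
    by_cases hli : l = i
    · subst hli
      rw [if_pos rfl, if_neg hij, if_neg hik, h.diag, hi, hji, hki]
      have : q = r * p := by linear_combination (r * p) * h1 - q * hrr * (p * p) - q * hpp
      have h2 : q * (1 * d) + r * p + p * r = q * (d + 2) := by rw [this]; ring
      rw [h2, mul_pow, pow_two q, hqq]
      linarith
    by_cases hlj : l = j
    · subst hlj
      rw [if_neg hli, if_pos rfl, if_neg hjk, h.diag, hj, hkj, ← hpdef]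
      have : r = p * q := by linear_combination (p * q) * h1 - r * hpp * (q * q) - r * hqq
      have h2 : q * p + r * (1 * d) + p * q = r * (d + 2) := by rw [this]; ring
      rw [h2, mul_pow, pow_two r, hrr]
      linarith
    by_cases hlk : l = k
    · subst hlk
      rw [if_neg hli, if_neg hlj, if_pos rfl, h.diag, hk, ← hrdef, ← hqdef]
      have : p = q * r := by linear_combination (q * r) * h1 - p * hqq * (r * r) - p * hrr
      have h2 : q * r + r * q + p * (1 * d) = p * (d + 2) := by rw [this]; ring
      rw [h2, mul_pow, pow_two p, hpp]
      linarith
    · rw [if_neg hli, if_neg hlj, if_neg hlk]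
      rcases mul_signs hq (h.off i l (Ne.symm hli)) with e1 | e1 <;>
      rcases mul_signs hr (h.off j l (Ne.symm hlj)) with e2 | e2 <;>
      rcases mul_signs hp (h.off k l (Ne.symm hlk)) with e3 | e3 <;>
      rw [e1, e2, e3] <;> norm_num
  have := Finset.sum_le_sum fun l (_ : l ∈ Finset.univ) => hle l
  rw [hsum] at this
  simp only [Finset.sum_add_distrib, Finset.sum_ite_eq', Finset.mem_univ, if_true,
    Finset.sum_const, Finset.card_univ, nsmul_eq_mul, mul_one] at this
  nlinarith

/-- With all triangles negative, the signs can be read off from one fixed row a of the class. -/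
theorem exists_block_signs [DecidableEq ι] (h : IsSignSymm d ε M)
    (hd : (Fintype.card ι : ℝ) < 6 * d + 6) :
    ∃ s : ι → ℝ, (∀ i, s i = 1 ∨ s i = -1) ∧
      ∀ i j, ε i = 1 → ε j = 1 → i ≠ j → M i j = -(s i * s j) := by
  by_cases hne : ∃ a, ε a = 1
  · obtain ⟨a, ha⟩ := hne
    refine ⟨fun i => if i = a then 1 else -M a i, fun i => ?_, fun i j hi hj hij => ?_⟩
    · by_cases hia : i = a
      · simp [hia]
      · rcases h.off a i (Ne.symm hia) with e | e <;> simp [hia, e]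
    · by_cases hia : i = a
      · subst hia
        simp [Ne.symm hij]
      by_cases hja : j = a
      · subst hja
        simp [hia, h.symm i j]
      simp only [hia, hja, if_false]
      have ht := h.triple hd (Ne.symm hia) (Ne.symm hja) hij ha hi hj
      have h1 := mul_self_of_sign (h.off a i (Ne.symm hia))
      have h2 := mul_self_of_sign (h.off a j (Ne.symm hja))
      linear_combination (M a i * M a j) * ht - M i j * h1 * (M a j * M a j) - M i j * h2
  · exact ⟨fun _ => 1, fun _ => Or.inl rfl, fun i j hi => absurd ⟨i, hi⟩ hne⟩

theorem exists_normal_form [DecidableEq ι] (h : IsSignSymm d ε M)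
    (hd : (Fintype.card ι : ℝ) < 6 * d + 6) :
    ∃ M' : Matrix ι ι ℝ, IsSignSymm d ε M' ∧ ∀ i j, ε i = ε j → i ≠ j → M' i j = -ε i := by
  obtain ⟨s, hs, hsM⟩ := h.exists_block_signs hd
  -- Negation exchanges the two classes of diagonal signs.
  obtain ⟨u, hu, huM⟩ := h.neg.exists_block_signs hd
  have ht : ∀ i, (if ε i = 1 then s i else u i) = 1 ∨ (if ε i = 1 then s i else u i) = -1 := by
    intro i
    split_ifs
    exacts [hs i, hu i]
  refine ⟨_, h.conj_signs ht, fun i j he hij => ?_⟩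
  simp only [Matrix.of_apply, ← he]
  rcases h.sign i with hi | hi
  · rw [if_pos hi, if_pos hi, hsM i j hi (he ▸ hi) hij, hi]
    linear_combination -(s j * s j) * mul_self_of_sign (hs i) - mul_self_of_sign (hs j)
  · have hne : ε i ≠ 1 := by rw [hi]; norm_num
    have := huM i j (by simp [hi]) (by simp [← he, hi]) hij
    rw [Matrix.neg_apply, neg_inj] at this
    rw [if_neg hne, if_neg hne, this, hi]
    linear_combination (u j * u j) * mul_self_of_sign (hu i) + mul_self_of_sign (hu j)

/-- Integrality of the inner product of two rows forces the order to be `2` modulo `4`. -/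
theorem card_eq [DecidableEq ι] (h : IsSignSymm d ε M) (hι : 2 < Fintype.card ι)
    (hd : d = (Fintype.card ι : ℝ) / 4 - 3 / 2) : ∃ m : ℕ, Fintype.card ι = 4 * m + 2 := by
  -- Pigeonhole on three indices. Equal diagonal signs make the two terms of the inner product at i
  -- and j add up rather than cancel.
  obtain ⟨i, j, hij, he⟩ : ∃ i j, i ≠ j ∧ ε i = ε j := by
    obtain ⟨a, b, c, hab, hac, hbc⟩ := Fintype.two_lt_card_iff.mp hι
    rcases h.sign a with ha | ha <;> rcases h.sign b with hb | hb <;>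
      rcases h.sign c with hc | hc
    all_goals first
      | exact ⟨a, b, hab, ha.trans hb.symm⟩
      | exact ⟨a, c, hac, ha.trans hc.symm⟩
      | exact ⟨b, c, hbc, hb.trans hc.symm⟩
  have ho := h.orth i j hij
  obtain ⟨z, hz⟩ := sum_signs_eq ({i, j}ᶜ : Finset ι) (fun k => M i k * M j k) fun k hk => by
    simp only [Finset.mem_compl, Finset.mem_insert, Finset.mem_singleton, not_or] at hk
    exact mul_signs (h.off i k (Ne.symm hk.1)) (h.off j k (Ne.symm hk.2))
  rw [← Finset.sum_add_sum_compl {i, j}, hz, Finset.sum_pair hij, Finset.card_compl,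
    Finset.card_pair hij, Nat.cast_sub hι.le, h.diag, h.diag, h.symm j i, ← he] at ho
  push_cast at ho
  have hcases : ε i * M i j = 1 ∨ ε i * M i j = -1 := mul_signs (h.sign i) (h.off i j hij)
  have ho' : 2 * d * (ε i * M i j) + ((Fintype.card ι : ℝ) - 2 + 2 * z) = 0 := by
    linear_combination ho
  generalize Fintype.card ι = n at *
  refine ⟨n / 4, ?_⟩
  rcases hcases with hc | hc
  · have : 3 * (n : ℝ) - 10 + 4 * z = 0 := by rw [hc, hd] at ho'; linarith
    have : 3 * (n : ℤ) - 10 + 4 * z = 0 := by exact_mod_cast this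
    omega
  · have : (n : ℝ) + 2 + 4 * z = 0 := by rw [hc, hd] at ho'; linarith
    have : (n : ℤ) + 2 + 4 * z = 0 := by exact_mod_cast this
    omega

end IsSignSymm

/-! ### Counting in the block form -/

theorem block_rowSum {ι : Type*} [DecidableEq ι] {P : Finset ι} {M : Matrix ι ι ℝ} {m : ℕ}
    (hPP : ∀ i ∈ P, ∀ l ∈ P, M i l = (if l = i then (m : ℝ) else 0) - 1) {i : ι} (hi : i ∈ P) :
    ∑ l ∈ P, M i l = m - P.card := by
  rw [Finset.sum_congr rfl (hPP i hi)]
  simp [hi]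

section Blocks

variable {ι : Type*} [Fintype ι] [DecidableEq ι] {P : Finset ι} {M : Matrix ι ι ℝ} {m : ℕ}

theorem sum_sq_colSum {R : ℝ} (P : Finset ι)
    (hMM : ∀ i j, ∑ k, M i k * M j k = if i = j then R else 0) :
    ∑ k, (∑ i ∈ P, M i k) ^ 2 = P.card * R := by
  have : ∀ k, (∑ i ∈ P, M i k) ^ 2 = ∑ i ∈ P, ∑ j ∈ P, M i k * M j k := fun k => by
    rw [pow_two, Finset.sum_mul_sum]
  simp only [this]
  rw [Finset.sum_comm]
  have h2 : ∀ i ∈ P, ∑ k, ∑ j ∈ P, M i k * M j k = R := by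
    intro i hi
    rw [Finset.sum_comm]
    simp [hMM, hi]
  rw [Finset.sum_congr rfl h2, Finset.sum_const, nsmul_eq_mul]

/-- The sum of the rows in P has squared norm |P|((m + 1)² + 1), while its coordinates in P alone
contribute |P|(|P| - m)². This is too much once |P| ≥ 2m + 2. -/
theorem block_card_le (hsymm : ∀ i j, M i j = M j i)
    (hPP : ∀ i ∈ P, ∀ l ∈ P, M i l = (if l = i then (m : ℝ) else 0) - 1)
    (hMM : ∀ i j, ∑ k, M i k * M j k = if i = j then ((m : ℝ) + 1) ^ 2 + 1 else 0) :
    P.card ≤ 2 * m + 1 := by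
  by_contra! hlt
  have h1 := sum_sq_colSum P hMM
  have h2 : ∑ k ∈ P, (∑ i ∈ P, M i k) ^ 2 ≤ ∑ k, (∑ i ∈ P, M i k) ^ 2 :=
    Finset.sum_le_sum_of_subset_of_nonneg (Finset.subset_univ P) fun _ _ _ => sq_nonneg _
  have h3 : ∑ k ∈ P, (∑ i ∈ P, M i k) ^ 2 = P.card * ((m : ℝ) - P.card) ^ 2 := by
    rw [Finset.sum_congr rfl fun k hk => by
      rw [Finset.sum_congr rfl fun i _ => hsymm i k, block_rowSum hPP hk], Finset.sum_const,
      nsmul_eq_mul]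
  rw [h1, h3] at h2
  have hc : (2 * m + 2 : ℝ) ≤ P.card := by exact_mod_cast hlt
  have hm : (0 : ℝ) ≤ m := Nat.cast_nonneg m
  have h4 := le_of_mul_le_mul_left h2 (by linarith)
  nlinarith

theorem exists_isHadamard_of_blocks (hcard : Fintype.card ι = 4 * m + 2)
    (hsymm : ∀ i j, M i j = M j i)
    (hPP : ∀ i ∈ P, ∀ l ∈ P, M i l = (if l = i then (m : ℝ) else 0) - 1)
    (hQQ : ∀ i ∈ Pᶜ, ∀ l ∈ Pᶜ, M i l = 1 - if l = i then (m : ℝ) else 0)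
    (hPQ : ∀ i ∈ P, ∀ l ∈ Pᶜ, M i l = 1 ∨ M i l = -1)
    (hMM : ∀ i j, ∑ k, M i k * M j k = if i = j then ((m : ℝ) + 1) ^ 2 + 1 else 0) :
    ∃ H : Matrix (Fin (2 * m + 2)) (Fin (2 * m + 2)) ℝ, H.IsHadamard := by
  have hP1 := block_card_le hsymm hPP hMM
  have hQ1 : Pᶜ.card ≤ 2 * m + 1 := by
    refine block_card_le (M := -M) (fun i j => by simp [hsymm i j]) (fun i hi l hl => ?_)
      fun i j => by simpa using hMM i j
    rw [Matrix.neg_apply, hQQ i hi l hl]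
    ring
  have hPQcard := Finset.card_compl P
  have hP : P.card = 2 * m + 1 := by omega
  have hQ : Pᶜ.card = 2 * m + 1 := by omega
  have hPr : (P.card : ℝ) = 2 * m + 1 := by exact_mod_cast hP
  have hQr : (Pᶜ.card : ℝ) = 2 * m + 1 := by exact_mod_cast hQ
  -- In the product of rows i and k the two terms m * `M i k` cancel, so each row sum of the mixed
  -- block equals each column sum.
  have hrc : ∀ i ∈ P, ∀ k ∈ Pᶜ, ∑ l ∈ Pᶜ, M i l = ∑ l ∈ P, M l k := by
    intro i hi k hk
    have hik : i ≠ k := fun e => (Finset.mem_compl.mp hk) (e ▸ hi)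
    have h0 := hMM i k
    rw [if_neg hik, ← Finset.sum_add_sum_compl P] at h0
    have e1 : ∑ l ∈ P, M i l * M k l = m * M k i - ∑ l ∈ P, M l k := by
      rw [Finset.sum_congr rfl fun l hl => by rw [hPP i hi l hl, hsymm k l, sub_mul, one_mul],
        Finset.sum_sub_distrib]
      simp [hi, hsymm k i]
    have e2 : ∑ l ∈ Pᶜ, M i l * M k l = ∑ l ∈ Pᶜ, M i l - m * M i k := by
      rw [Finset.sum_congr rfl fun l hl => by rw [hQQ k hk l hl, mul_sub, mul_one],
        Finset.sum_sub_distrib]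
      simp [Finset.mem_compl.mp hk, mul_comm]
    rw [e1, e2, hsymm k i] at h0
    linarith
  obtain ⟨i₀, hi₀⟩ : P.Nonempty := Finset.card_pos.mp (by omega)
  obtain ⟨k₀, hk₀⟩ : Pᶜ.Nonempty := Finset.card_pos.mp (by omega)
  obtain ⟨c, hc⟩ : ∃ c, c = ∑ l ∈ Pᶜ, M i₀ l := ⟨_, rfl⟩
  have hcol : ∀ k ∈ Pᶜ, ∑ l ∈ P, M l k = c := fun k hk => by rw [hc, hrc i₀ hi₀ k hk]
  have hrow : ∀ i ∈ P, ∑ l ∈ Pᶜ, M i l = c := fun i hi => by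
    rw [hrc i hi k₀ hk₀, hcol k₀ hk₀]
  -- The squared norm of the sum of the rows in P, split over P and its complement.
  have hcc : c * c = 1 := by
    have h1 := sum_sq_colSum P hMM
    have e1 : ∑ k ∈ P, (∑ i ∈ P, M i k) ^ 2 = P.card * ((m : ℝ) - P.card) ^ 2 := by
      rw [Finset.sum_congr rfl fun k hk => by
        rw [Finset.sum_congr rfl fun i _ => hsymm i k, block_rowSum hPP hk], Finset.sum_const,
        nsmul_eq_mul]
    have e2 : ∑ k ∈ Pᶜ, (∑ i ∈ P, M i k) ^ 2 = Pᶜ.card * c ^ 2 := by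
      rw [Finset.sum_congr rfl fun k hk => by rw [hcol k hk], Finset.sum_const, nsmul_eq_mul]
    rw [← Finset.sum_add_sum_compl P, e1, e2, hPr, hQr] at h1
    have hpos : (2 * m + 1 : ℝ) ≠ 0 := by positivity
    apply mul_left_cancel₀ hpos
    linear_combination h1
  have hcs : -c = 1 ∨ -c = -1 := by
    rcases mul_self_eq_one_iff.mp hcc with h | h <;> simp [h]
  have hort : ∀ i ∈ P, ∀ j ∈ P, i ≠ j → ∑ k ∈ Pᶜ, M i k * M j k = -1 := by
    intro i hi j hj hij
    have h0 := hMM i j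
    rw [if_neg hij, ← Finset.sum_add_sum_compl P] at h0
    have e1 : ∑ l ∈ P, M i l * M j l = m * M i j - ∑ l ∈ P, M i l := by
      rw [Finset.sum_congr rfl fun l hl => by rw [hPP j hj l hl, mul_sub, mul_one],
        Finset.sum_sub_distrib]
      simp [hj, mul_comm]
    rw [e1, block_rowSum hPP hi, hPP i hi j hj, if_neg (Ne.symm hij), hPr] at h0
    linarith
  -- The factor -c makes all row sums -1, so that the rows are orthogonal to the added row of ones.
  let H₀ : Option P → Option (Pᶜ : Finset ι) → ℝ := fun a b =>
    match a, b with
    | some i, some k => -c * M i k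
    | _, _ => 1
  have hH₀ : ∀ a b, a ≠ b → ∑ k, H₀ a k * H₀ b k = 0 := by
    have hr : ∀ i : P, ∑ k : (Pᶜ : Finset ι), -c * M i k = -1 := fun i => by
      rw [← Finset.mul_sum, Finset.sum_coe_sort Pᶜ (fun k => M i k), hrow i i.2]
      linear_combination -hcc
    rintro (_ | i) (_ | j) hab
    · exact absurd rfl hab
    · simp only [H₀, Fintype.sum_option, one_mul]
      rw [hr]; ring
    · simp only [H₀, Fintype.sum_option, mul_one]
      rw [hr]; ring
    · have hij : (i : ι) ≠ j := fun e => hab (by rw [Subtype.ext e])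
      simp only [H₀, Fintype.sum_option, mul_one]
      have : ∀ k, -c * M i k * (-c * M j k) = M i k * M j k := fun k => by
        linear_combination (M i k * M j k) * hcc
      simp only [this]
      rw [Finset.sum_coe_sort Pᶜ (fun k => M i k * M j k), hort i i.2 j j.2 hij]
      ring
  have hH₀s : ∀ a b, H₀ a b = 1 ∨ H₀ a b = -1 := by
    rintro (_ | i) (_ | j)
    · exact Or.inl rfl
    · exact Or.inl rfl
    · exact Or.inl rfl
    · exact mul_signs hcs (hPQ i i.2 j j.2)
  have eP : Fin (2 * m + 2) ≃ Option P := (Fintype.equivFinOfCardEq (by simp [hP])).symm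
  have eQ : Fin (2 * m + 2) ≃ Option (Pᶜ : Finset ι) :=
    (Fintype.equivFinOfCardEq (by rw [Fintype.card_option, Fintype.card_coe, hQ])).symm
  refine ⟨Matrix.of fun a b => H₀ (eP a) (eQ b), Matrix.isHadamard_of_signs
    (fun _ _ => hH₀s _ _) fun a b hab => ?_⟩
  have := hH₀ (eP a) (eP b) (fun e => hab (eP.injective e))
  rw [← eQ.sum_comp] at this
  exact this

end Blocks

/-! ### Assembly of the equivalence -/

theorem IsSignSymm.exists_isHadamard {ι : Type*} [Fintype ι] [DecidableEq ι] {d : ℝ} {ε : ι → ℝ}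
    {M : Matrix ι ι ℝ} (h : IsSignSymm d ε M) {m : ℕ} (hm : 1 < m)
    (hcard : Fintype.card ι = 4 * m + 2) (hd : d = m - 1) :
    ∃ H : Matrix (Fin (2 * m + 2)) (Fin (2 * m + 2)) ℝ, H.IsHadamard := by
  have hm' : (2 : ℝ) ≤ m := by exact_mod_cast hm
  -- The bound n < 6d + 6 reads 4m + 2 < 6m, which is where m > 1 enters.
  obtain ⟨M', h', hblock⟩ := h.exists_normal_form (by rw [hcard, hd]; push_cast; linarith)
  have hneg : ∀ i, i ∈ (Finset.univ.filter fun i => ε i = 1)ᶜ → ε i = -1 := fun i hi =>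
    (h.sign i).resolve_left (by simpa using hi)
  refine exists_isHadamard_of_blocks (P := Finset.univ.filter fun i => ε i = 1) hcard h'.symm
    ?_ ?_ ?_ ?_
  · intro i hi l hl
    rw [Finset.mem_filter] at hi hl
    by_cases e : l = i
    · subst e
      rw [if_pos rfl, h'.diag, hi.2, hd, one_mul]
    · rw [if_neg e, hblock i l (hi.2.trans hl.2.symm) (Ne.symm e), hi.2, zero_sub]
  · intro i hi l hl
    by_cases e : l = i
    · subst e
      rw [if_pos rfl, h'.diag, hneg l hl, hd]
      ring
    · rw [if_neg e, hblock i l ((hneg i hi).trans (hneg l hl).symm) (Ne.symm e), hneg i hi]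
      ring
  · intro i hi l hl
    exact h'.off i l fun e => (Finset.mem_compl.mp hl) (e ▸ hi)
  · intro i j
    by_cases e : i = j
    · subst e
      rw [if_pos rfl, h'.sum_mul_self, hcard, hd]
      push_cast
      ring
    · rw [if_neg e, h'.orth i j e]

theorem exists_isSignSymm_of_mem_realM {n : ℕ} (hn : 2 < n) {d : ℝ}
    {S : Matrix (Fin n) (Fin n) ℝ} (hS : S ∈ realM n d) :
    ∃ ε M, IsSignSymm (ι := Fin n) d ε M := by
  obtain ⟨hO, ⟨a, b, -, hb, hSa, hSb⟩, hr, hsymm⟩ := hS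
  obtain ⟨i₀, j₀, -, hij, -⟩ := (Fintype.two_lt_card_iff (α := Fin n)).mp (by simpa using hn)
  have hb0 : b ≠ 0 := by
    rw [← hSb i₀ j₀ hij]
    exact abs_ne_zero.mpr (hr i₀ j₀ hij).1
  have had : a = d * b := by
    have := (hr i₀ j₀ hij).2
    rw [hSa, hSb i₀ j₀ hij, div_eq_iff hb0] at this
    exact this
  rw [Matrix.mem_orthogonalGroup_iff] at hO
  refine ⟨fun i => if 0 ≤ S i i then 1 else -1, Matrix.of fun i j => S i j / b, ?_, ?_, ?_, ?_, ?_⟩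
  · intro i j
    simp only [Matrix.of_apply]
    rw [hsymm.apply]
  · intro i
    by_cases h : 0 ≤ S i i <;> simp [h]
  · intro i
    have h1 := hSa i
    simp only [Matrix.of_apply]
    rw [div_eq_iff hb0, mul_assoc, ← had]
    split_ifs with h
    · rw [← h1, abs_of_nonneg h, one_mul]
    · rw [← h1, abs_of_neg (not_le.mp h)]
      ring
  · intro i j h
    simp only [Matrix.of_apply]
    have h1 := hSb i j h
    rcases (abs_eq hb).mp h1 with e | e
    · left
      rw [e, div_self hb0]
    · right
      rw [e, neg_div, div_self hb0]
  · intro i j h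
    have h1 := congr_fun (congr_fun hO i) j
    rw [Matrix.one_apply_ne h, Matrix.mul_apply] at h1
    have h2 : ∀ k, S i k / b * (S j k / b) = (S i k * S j k) / (b * b) := fun k =>
      div_mul_div_comm _ _ _ _
    simp only [Matrix.of_apply, h2, ← Finset.sum_div]
    rw [div_eq_zero_iff]
    exact Or.inl h1

theorem mainTheorem6 (n : ℕ) (hn : 2 < n) :
    (∃ S : Matrix (Fin n) (Fin n) ℝ, S ∈ realM n ((n : ℝ) / 4 - 3 / 2)) ↔
      ∃ N : ℕ, (N : ℝ) = (n : ℝ) / 2 + 1 ∧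
        ∃ H : Matrix (Fin N) (Fin N) ℝ, H.IsHadamard := by
  constructor
  · rintro ⟨S, hS⟩
    obtain ⟨ε, M, hM⟩ := exists_isSignSymm_of_mem_realM hn hS
    obtain ⟨m, hm⟩ := hM.card_eq ((Fintype.card_fin n).symm ▸ hn) (by simp)
    rw [Fintype.card_fin] at hm
    refine ⟨2 * m + 2, by rw [hm]; push_cast; ring, ?_⟩
    rcases Nat.lt_or_ge 1 m with h | h
    · exact hM.exists_isHadamard h (by simpa using hm) (by rw [hm]; push_cast; ring)
    · obtain rfl : m = 1 := by omega
      exact exists_isHadamard_four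
  · rintro ⟨N, hN, H, hH⟩
    have h2 : 2 * N = n + 2 := by
      have : (2 * N : ℝ) = n + 2 := by linarith
      exact_mod_cast this
    obtain ⟨k, rfl⟩ : ∃ k, N = k + 1 := ⟨N - 1, by omega⟩
    obtain rfl : n = k + k := by omega
    have hd : ((k + k : ℕ) : ℝ) / 4 - 3 / 2 = ((k : ℝ) - 3) / 2 := by push_cast; ring
    rw [hd]
    exact exists_mem_realM_of_isHadamard (by omega) hH
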